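/- Let $(X,d)$ be a complete separable metric space and let $(\omega_n)_{n\ge 1}$ be independent random variables on a probability space $(\Omega,\mathscr A,\mathbb P)$ with values in $X$ and with the same distribution $\mu$, a Borel probability measure on $X$. Assume that $\mu$ is non-atomic in the sense that $\mu(\{y\in X: d(y,x)=r\})=0$ for all $x\in X$ and $r\ge 0$. Let $\alpha>0$ and $\ell_n=n^{-\alpha}$ for $n\ge1$, and put $$\mathcal U(\omega,\ell)=\{y\in X:\ \text{for all sufficiently large } N \text{ there is } 1\le n\le N \text{ with } d(\omega_n,y)<\ell_N\}.$$ For $y$ in the support of $\mu$ let $$\overline d_\mu(y)=\limsup_{r\searrow0}\frac{\log\mu(B(y,r))}{\log r},\qquad \underline d_\mu(y)=\liminf_{r\searrow0}\frac{\log\mu(B(y,r))}{\log r},$$ where $B(y,r)$ is the open ball with center $y$ and radius $r$, and let $\overline d_\mu(y)=\underline d_\mu(y)=\infty$ for $y$ outside the support of $\mu$. Then, almost surely, $$\dim_{\rm H}\Big\{y\in X:\overline d_\mu(y)<\frac1\alpha\Big\}\ \le\ \dim_{\rm H}\mathcal U(\omega,\ell)\ \le\ \dim_{\rm H}\Big\{y\in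 X:\underline d_\mu(y)\le\frac1\alpha\Big\},$$ where $\dim_{\rm H}$ is the Hausdorff dimension, with $\dim_{\rm H}\emptyset=0$. -/

import Mathlib

namespace UniformRandomCovering

open MeasureTheory Filter Topology

/-- The upper local dimension `limsup_{r ↓ 0} log μ(B(y,r)) / log r` of a measure at a point `y` of
its support, as an extended real number; it is `∞` off the support. For `y` in the support,
`μ (B(y,r))` is positive for every `r > 0`, so that the logarithm is a genuine one when `μ` is
finite. -/
noncomputable def upperLocalDim {X : Type*} [MetricSpace X] [MeasurableSpace X]
    (μ : Measure X) (y : X) : EReal :=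
  open Classical in
  if y ∈ μ.support then
    limsup (fun r : ℝ => ((Real.log (μ.real (Metric.ball y r)) / Real.log r : ℝ) : EReal)) (𝓝[>] 0)
  else ⊤

/-- The lower local dimension `liminf_{r ↓ 0} log μ(B(y,r)) / log r` of a measure at a point `y` of
its support, as an extended real number; it is `∞` off the support. -/
noncomputable def lowerLocalDim {X : Type*} [MetricSpace X] [MeasurableSpace X]
    (μ : Measure X) (y : X) : EReal :=
  open Classical in
  if y ∈ μ.support then
    liminf (fun r : ℝ => ((Real.log (μ.real (Metric.ball y r)) / Real.log r : ℝ) : EReal)) (𝓝[>] 0)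
  else ⊤

/-- The uniform covering set of a sequence of points `x₁, x₂, …` and of radii `ℓ₁, ℓ₂, …`: the points
`y` such that for all large `N` there is `1 ≤ n ≤ N` with `d(xₙ, y) < ℓ_N`. -/
def uniformCoveringSet {X : Type*} [MetricSpace X] (x : ℕ+ → X) (ℓ : ℕ+ → ℝ) : Set X :=
  {y | ∀ᶠ N : ℕ+ in atTop, ∃ n : ℕ+, n ≤ N ∧ dist (x n) y < ℓ N}

/-- The strong form of non-atomicity: every sphere, including those of radius `0`, is a null set. -/
def SphereNull {X : Type*} [MetricSpace X] [MeasurableSpace X] (μ : Measure X) : Prop :=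
  ∀ (x : X) (r : ℝ), 0 ≤ r → μ {y | dist y x = r} = 0

end UniformRandomCovering

/-!
Almost surely the three sets are nested, up to a countable set: with `U` the uniform covering set,

`{upperLocalDim μ < 1 / α} ⊆ U ⊆ {lowerLocalDim μ ≤ 1 / α} ∪ {ω₁, ω₂, …}`,

and a countable set does not affect the Hausdorff dimension.

*First inclusion.* Let `s < 1 / α`, and let `F` be the set of points `y` with `r ^ s ≤ μ (B(y, r))`
for all small `r`, uniformly in `y`. As disjoint balls have total mass at most `1`, a separated
subset of `F` at scale `ℓ_N = N ^ (-α)` has `O(N ^ (α s))` points, so `F` has a net of that size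
(`exists_finset_net`). A ball of radius comparable to `ℓ_N` around a point of the net is missed by
the first `N` variables with probability at most `exp (-c N ^ (1 - α s))`
(`measure_forall_notMem_le`). The union bound is summable in `N`, and the Borel–Cantelli lemma gives
`F ⊆ U` (`ae_forall_eventually_exists_dist_lt`).

*Second inclusion.* Let `s > 1 / α`, and let `y ∈ U` satisfy `μ (B(y, r)) ≤ r ^ s` for small `r`, and
differ from all `ω_n`. The successive times at which `dist ω_n y` attains a new minimum form an
infinite chain. If `n` is the record following `m`, then at time `n - 1` the nearest point to `y` is
still `ω_m`, so that `ω_n` lies in a ball around `ω_m` of radius comparable to `n ^ (-α)`, and of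
measure `O(n ^ (-α s))`. As `ω_n` is independent of the earlier variables, the expected number of
chains of length `j` from a given starting point is at most the `j`-th power of a tail of the
convergent series `∑ C n ^ (-α s)` (`tsum_measure_chainEvent_le`). Once the tail is less than `1`
this tends to `0`, so almost surely there is no infinite chain (`ae_forall_mem_range`).

Outside the final theorem the variables are indexed by `ℕ`, with radii `(N + 1) ^ (-α)`.
-/

namespace UniformRandomCovering

open MeasureTheory ProbabilityTheory Filter Topology Set

/-! ### Points of small upper local dimension are uniformly covered -/

theorem exists_finset_net {X : Type*} [MetricSpace X] [MeasurableSpace X] [OpensMeasurableSpace X]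
    (μ : Measure X) [IsProbabilityMeasure μ] (F : Set X) {r c : ℝ} (hc : 0 < c)
    (h : ∀ y ∈ F, c ≤ μ.real (Metric.ball y (r / 2))) :
    ∃ T : Finset X, (T : Set X) ⊆ F ∧ (T.card : ℝ) ≤ c⁻¹ ∧ ∀ y ∈ F, ∃ t ∈ T, dist t y < r := by
  classical
  let Sep : Finset X → Prop := fun T => (T : Set X) ⊆ F ∧
    (T : Set X).Pairwise fun x y => r ≤ dist x y
  have hcard : ∀ T, Sep T → (T.card : ℝ) ≤ c⁻¹ := by
    intro T hT
    have hdisj : (T : Set X).PairwiseDisjoint fun t => Metric.ball t (r / 2) := by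
      intro x hx y hy hxy
      exact Metric.ball_disjoint_ball (by linarith [hT.2 hx hy hxy])
    have h1 : ∑ t ∈ T, μ.real (Metric.ball t (r / 2)) ≤ 1 := by
      rw [← measureReal_biUnion_finset hdisj fun _ _ => measurableSet_ball]
      exact measureReal_le_one
    have h2 : T.card • c ≤ ∑ t ∈ T, μ.real (Metric.ball t (r / 2)) :=
      Finset.card_nsmul_le_sum _ _ _ fun t ht => h t (hT.1 ht)
    rw [nsmul_eq_mul] at h2
    rw [← one_div, le_div_iff₀ hc]
    exact h2.trans h1
  -- A separated subset of maximal cardinality is a net.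
  obtain ⟨k, ⟨T, hT, rfl⟩, hmax⟩ : ∃ k, (∃ T, Sep T ∧ T.card = k) ∧
      ∀ l, (∃ T, Sep T ∧ T.card = l) → l ≤ k := by
    have hbdd : BddAbove {l | ∃ T, Sep T ∧ T.card = l} := by
      refine ⟨⌊c⁻¹⌋₊, ?_⟩
      rintro _ ⟨T, hT, rfl⟩
      exact Nat.le_floor (hcard T hT)
    have hne : {l | ∃ T, Sep T ∧ T.card = l}.Nonempty := ⟨0, ∅, by simp [Sep], by simp⟩
    exact ⟨_, Nat.sSup_mem hne hbdd, fun l hl => le_csSup hbdd hl⟩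
  refine ⟨T, hT.1, hcard T hT, fun y hy => ?_⟩
  by_contra! hfar
  by_cases hyT : y ∈ T
  · have hpos : r ≤ 0 := by simpa using hfar y hyT
    have hcy := h y hy
    rw [Metric.ball_eq_empty.2 (by linarith)] at hcy
    simp at hcy
    linarith
  · have hsep : Sep (insert y T) := by
      refine ⟨?_, ?_⟩
      · rw [Finset.coe_insert]
        exact insert_subset hy hT.1
      · rw [Finset.coe_insert]
        refine hT.2.insert fun t ht _ => ⟨?_, hfar t ht⟩
        rw [dist_comm]
        exact hfar t ht
    have := hmax _ ⟨_, hsep, rfl⟩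
    rw [Finset.card_insert_of_notMem hyT] at this
    omega

theorem measure_forall_notMem_le {X Ω : Type*} [MeasurableSpace X] [MeasurableSpace Ω]
    {P : Measure Ω} [IsProbabilityMeasure P] {μ : Measure X} {ξ : ℕ → Ω → X}
    (hmeas : ∀ n, Measurable (ξ n)) (hindep : iIndepFun ξ P) (hlaw : ∀ n, P.map (ξ n) = μ)
    {B : Set X} (hB : MeasurableSet B) (N : ℕ) :
    P.real {o | ∀ n ≤ N, ξ n o ∉ B} ≤ Real.exp (-((N + 1 : ℝ) * μ.real B)) := by
  have : IsProbabilityMeasure μ := by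
    rw [← hlaw 0]
    exact Measure.isProbabilityMeasure_map (hmeas 0).aemeasurable
  have hset : {o | ∀ n ≤ N, ξ n o ∉ B} = ⋂ n ∈ Finset.range (N + 1), ξ n ⁻¹' Bᶜ := by
    ext o
    simp
  have hprod : P.real {o | ∀ n ≤ N, ξ n o ∉ B} = (1 - μ.real B) ^ (N + 1) := by
    rw [hset, measureReal_def, hindep.measure_inter_preimage_eq_mul _ (fun _ _ => hB.compl),
      ENNReal.toReal_prod, ← probReal_compl_eq_one_sub hB, measureReal_def]
    simp_rw [← Measure.map_apply (hmeas _) hB.compl, hlaw]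
    simp
  rw [hprod]
  calc (1 - μ.real B) ^ (N + 1) ≤ Real.exp (-μ.real B) ^ (N + 1) :=
        pow_le_pow_left₀ (by linarith [measureReal_le_one (μ := μ) (s := B)])
          (Real.one_sub_le_exp_neg _) _
    _ = _ := by
        rw [← Real.exp_nat_mul]
        push_cast
        ring_nf

theorem summable_rpow_mul_exp_neg_rpow (a : ℝ) {b c : ℝ} (hb : 0 < b) (hc : 0 < c) :
    Summable fun n : ℕ => ((n : ℝ) + 1) ^ a * Real.exp (-(c * ((n : ℝ) + 1) ^ b)) := by
  have h1 : (fun x : ℝ => Real.exp (-(c * x ^ b))) =o[atTop] fun x : ℝ => x ^ (-(a + 2)) := by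
    have h := (isLittleO_exp_neg_mul_rpow_atTop hc (-(a + 2) / b)).comp_tendsto
      (tendsto_rpow_atTop hb)
    refine h.congr' (Eventually.of_forall fun x => by simp) ?_
    filter_upwards [eventually_gt_atTop 0] with x hx
    simp only [Function.comp_apply]
    rw [← Real.rpow_mul hx.le]
    congr 1
    field_simp
  have h2 : (fun x : ℝ => x ^ a * Real.exp (-(c * x ^ b))) =O[atTop] fun x : ℝ => x ^ (-2 : ℝ) := by
    refine ((Asymptotics.isBigO_refl (fun x : ℝ => x ^ a) atTop).mul h1.isBigO).congr'
      EventuallyEq.rfl ?_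
    filter_upwards [eventually_gt_atTop 0] with x hx
    rw [← Real.rpow_add hx]
    congr 1
    ring
  have h3 := h2.comp_tendsto tendsto_natCast_atTop_atTop
  have h4 : Summable fun n : ℕ => (n : ℝ) ^ a * Real.exp (-(c * (n : ℝ) ^ b)) :=
    summable_of_isBigO_nat (Real.summable_nat_rpow.2 (by norm_num)) h3
  simpa using (summable_nat_add_iff 1).2 h4

/-- The balls of radius `ℓ_N / 2` around a net of cardinality `O(N ^ (α s))` are all hit before
time `N` up to a probability `O(N ^ (α s) * exp (-c * N ^ (1 - α s)))`, which is summable. -/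
theorem ae_forall_eventually_exists_dist_lt {X Ω : Type*} [MetricSpace X] [MeasurableSpace X]
    [OpensMeasurableSpace X] [MeasurableSpace Ω]
    {P : Measure Ω} [IsProbabilityMeasure P] {μ : Measure X} {ξ : ℕ → Ω → X}
    (hmeas : ∀ n, Measurable (ξ n)) (hindep : iIndepFun ξ P) (hlaw : ∀ n, P.map (ξ n) = μ)
    {α s : ℝ} (hα : 0 < α) (hs : α * s < 1) :
    ∀ᵐ o ∂P, ∀ y, (∀ᶠ r in 𝓝[>] (0 : ℝ), r ^ s ≤ μ.real (Metric.ball y r)) →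
      ∀ᶠ N : ℕ in atTop, ∃ n ≤ N, dist (ξ n o) y < ((N : ℝ) + 1) ^ (-α) := by
  have : IsProbabilityMeasure μ := by
    rw [← hlaw 0]
    exact Measure.isProbabilityMeasure_map (hmeas 0).aemeasurable
  let F : ℕ → Set X := fun k => {y | ∀ r : ℝ, 0 < r → r < 1 / ((k : ℝ) + 1) →
    r ^ s ≤ μ.real (Metric.ball y r)}
  have hF : ∀ y, (∀ᶠ r in 𝓝[>] (0 : ℝ), r ^ s ≤ μ.real (Metric.ball y r)) → ∃ k, y ∈ F k := by
    intro y hy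
    obtain ⟨δ, hδ, hδy⟩ := mem_nhdsGT_iff_exists_Ioo_subset.1 hy
    obtain ⟨k, hk⟩ := exists_nat_one_div_lt (mem_Ioi.1 hδ)
    exact ⟨k, fun r h0 hr => hδy ⟨h0, hr.trans hk⟩⟩
  suffices H : ∀ k, ∀ᵐ o ∂P, ∀ᶠ N : ℕ in atTop, ∀ y ∈ F k,
      ∃ n ≤ N, dist (ξ n o) y < ((N : ℝ) + 1) ^ (-α) by
    filter_upwards [ae_all_iff.2 H] with o ho y hy
    obtain ⟨k, hk⟩ := hF y hy
    exact (ho k).mono fun N hN => hN y hk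
  intro k
  let bad : ℕ → Set Ω := fun N => {o | ∃ y ∈ F k, ∀ n ≤ N, ((N : ℝ) + 1) ^ (-α) ≤ dist (ξ n o) y}
  have hbound : ∀ᶠ N : ℕ in atTop, P.real (bad N) ≤
      4 ^ s * (((N : ℝ) + 1) ^ (α * s) *
        Real.exp (-((1 / 2) ^ s * ((N : ℝ) + 1) ^ (1 - α * s)))) := by
    have hlim : Tendsto (fun N : ℕ => ((N : ℝ) + 1) ^ (-α)) atTop (𝓝 0) :=
      (tendsto_rpow_neg_atTop hα).comp
        (tendsto_atTop_add_const_right _ _ tendsto_natCast_atTop_atTop)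
    filter_upwards [hlim.eventually_lt_const (Nat.one_div_pos_of_nat (n := k) (α := ℝ))] with N hN
    have hN0 : (0 : ℝ) < (N : ℝ) + 1 := by positivity
    set ℓ : ℝ := ((N : ℝ) + 1) ^ (-α) with hℓ
    have hℓ0 : 0 < ℓ := by positivity
    have hℓs : ℓ ^ s = ((N : ℝ) + 1) ^ (-(α * s)) := by
      rw [hℓ, ← Real.rpow_mul hN0.le]
      ring_nf
    obtain ⟨T, hTF, hTc, hT⟩ := exists_finset_net μ (F k) (r := ℓ / 2) (c := (ℓ / 2 / 2) ^ s)
      (by positivity) (fun y hy => hy _ (by positivity) (by linarith))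
    have hsub : bad N ⊆ ⋃ t ∈ T, {o | ∀ n ≤ N, ξ n o ∉ Metric.ball t (ℓ / 2)} := by
      rintro o ⟨y, hy, hoy⟩
      obtain ⟨t, ht, hty⟩ := hT y hy
      refine mem_iUnion₂.2 ⟨t, ht, fun n hn hmem => ?_⟩
      rw [Metric.mem_ball] at hmem
      linarith [hoy n hn, dist_triangle (ξ n o) t y]
    have hmiss : ∀ t ∈ T, P.real {o | ∀ n ≤ N, ξ n o ∉ Metric.ball t (ℓ / 2)} ≤
        Real.exp (-((1 / 2) ^ s * ((N : ℝ) + 1) ^ (1 - α * s))) := by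
      intro t ht
      refine (measure_forall_notMem_le hmeas hindep hlaw measurableSet_ball N).trans ?_
      have h1 : (ℓ / 2) ^ s ≤ μ.real (Metric.ball t (ℓ / 2)) :=
        hTF ht _ (by positivity) (by linarith)
      have h2 : (1 / 2) ^ s * ((N : ℝ) + 1) ^ (1 - α * s) = ((N : ℝ) + 1) * (ℓ / 2) ^ s := by
        rw [div_eq_mul_one_div ℓ 2, Real.mul_rpow hℓ0.le (by norm_num), hℓs, sub_eq_add_neg,
          Real.rpow_add hN0, Real.rpow_one]
        ring
      rw [h2]
      gcongr
    calc P.real (bad N)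
        ≤ ∑ t ∈ T, P.real {o | ∀ n ≤ N, ξ n o ∉ Metric.ball t (ℓ / 2)} :=
          (measureReal_mono hsub (measure_ne_top _ _)).trans (measureReal_biUnion_finset_le _ _)
      _ ≤ T.card • Real.exp (-((1 / 2) ^ s * ((N : ℝ) + 1) ^ (1 - α * s))) :=
          Finset.sum_le_card_nsmul _ _ _ hmiss
      _ ≤ ((ℓ / 2 / 2) ^ s)⁻¹ * Real.exp (-((1 / 2) ^ s * ((N : ℝ) + 1) ^ (1 - α * s))) := by
          rw [nsmul_eq_mul]
          gcongr
      _ = _ := by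
          rw [div_div, Real.div_rpow hℓ0.le (by norm_num), hℓs, Real.rpow_neg hN0.le, inv_div,
            div_inv_eq_mul, ← mul_assoc]
          norm_num
  have hsum : Summable fun N => P.real (bad N) := by
    refine summable_of_isBigO_nat ((summable_rpow_mul_exp_neg_rpow (α * s) (b := 1 - α * s)
      (c := (1 / 2) ^ s) (by linarith) (by positivity)).mul_left (4 ^ s)) ?_
    refine Asymptotics.IsBigO.of_bound 1 (hbound.mono fun N hN => ?_)
    rw [one_mul, Real.norm_of_nonneg measureReal_nonneg]
    exact hN.trans (le_abs_self _)
  have hBC : ∑' N, P (bad N) ≠ ⊤ := by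
    have h := hsum.tsum_ofReal_ne_top
    simpa using h
  filter_upwards [ae_eventually_notMem hBC] with o ho
  filter_upwards [ho] with N hN y hy
  by_contra! h
  exact hN ⟨y, hy, h⟩

/-! ### Chains of random points -/

/-- The event that there is a chain `a = n₀ < n₁ < ⋯ < n_j = n` of length `j` from `a` to `n` with
`(ξ n_i, ξ n_{i+1}) ∈ Λ n_{i+1}` for all `i < j`. -/
def chainEvent {X Ω : Type*} (ξ : ℕ → Ω → X) (Λ : ℕ → Set (X × X)) (a : ℕ) : ℕ → ℕ → Set Ω
  | 0, n => {_o | n = a}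
  | j + 1, n => ⋃ m ∈ Finset.range n, chainEvent ξ Λ a j m ∩ {o | (ξ m o, ξ n o) ∈ Λ n}

/-- The measurable space on `Ω` is arbitrary, so that the lemma applies to the `σ`-algebra
generated by the first `n + 1` variables. -/
theorem measurableSet_chainEvent {X Ω : Type*} [MeasurableSpace X] [MeasurableSpace Ω]
    {ξ : ℕ → Ω → X} {Λ : ℕ → Set (X × X)} (hΛ : ∀ n, MeasurableSet (Λ n)) (a j : ℕ) :
    ∀ n, (∀ i ≤ n, Measurable (ξ i)) → MeasurableSet (chainEvent ξ Λ a j n) := by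
  induction j with
  | zero => intro n _; exact MeasurableSet.const _
  | succ j ih =>
    intro n hn
    refine Finset.measurableSet_biUnion _ fun m hm => ?_
    have hmn : m < n := Finset.mem_range.1 hm
    exact (ih m fun i hi => hn i (hi.trans hmn.le)).inter
      ((hn m hmn.le).prodMk (hn n le_rfl) (hΛ n))

theorem measure_preimage_inter_le {Ω β γ : Type*} [MeasurableSpace Ω] [MeasurableSpace β]
    [MeasurableSpace γ] {P : Measure Ω} [IsProbabilityMeasure P] {Y : Ω → β} {Z : Ω → γ}
    (hY : Measurable Y) (hZ : Measurable Z) (hYZ : IndepFun Y Z P) {S : Set β}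
    (hS : MeasurableSet S) {T : Set (β × γ)} (hT : MeasurableSet T) {q : ENNReal}
    (hq : ∀ y, P.map Z (Prod.mk y ⁻¹' T) ≤ q) :
    P (Y ⁻¹' S ∩ (fun o => (Y o, Z o)) ⁻¹' T) ≤ P (Y ⁻¹' S) * q := by
  have := Measure.isProbabilityMeasure_map (μ := P) hZ.aemeasurable
  have := Measure.isProbabilityMeasure_map (μ := P) hY.aemeasurable
  have hST : MeasurableSet ((S ×ˢ univ) ∩ T) := (hS.prod MeasurableSet.univ).inter hT
  have h1 : Y ⁻¹' S ∩ (fun o => (Y o, Z o)) ⁻¹' T =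
      (fun o => (Y o, Z o)) ⁻¹' ((S ×ˢ univ) ∩ T) := by
    ext o
    simp
  rw [h1, ← Measure.map_apply (hY.prodMk hZ) hST,
    (indepFun_iff_map_prod_eq_prod_map_map hY.aemeasurable hZ.aemeasurable).1 hYZ,
    Measure.prod_apply hST, ← Measure.map_apply hY hS]
  calc ∫⁻ y, P.map Z (Prod.mk y ⁻¹' ((S ×ˢ univ) ∩ T)) ∂(P.map Y)
      ≤ ∫⁻ y, S.indicator (fun _ => q) y ∂(P.map Y) := by
        refine lintegral_mono fun y => ?_
        by_cases hy : y ∈ S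
        · rw [indicator_of_mem hy]
          exact (measure_mono fun z hz => hz.2).trans (hq y)
        · have : Prod.mk y ⁻¹' ((S ×ˢ univ) ∩ T) = ∅ := by
            ext z
            simp [hy]
          rw [this]
          simp
    _ = P.map Y S * q := by rw [lintegral_indicator_const hS, mul_comm]

theorem measure_chainEvent_inter_le {X Ω : Type*} [MeasurableSpace X] [MeasurableSpace Ω]
    {P : Measure Ω} [IsProbabilityMeasure P] {μ : Measure X} {ξ : ℕ → Ω → X}
    (hmeas : ∀ n, Measurable (ξ n)) (hindep : iIndepFun ξ P) (hlaw : ∀ n, P.map (ξ n) = μ)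
    {Λ : ℕ → Set (X × X)} (hΛ : ∀ n, MeasurableSet (Λ n)) {q : ℕ → ENNReal}
    (hq : ∀ n x, μ (Prod.mk x ⁻¹' Λ n) ≤ q n) (a j : ℕ) {m n : ℕ} (hmn : m < n) :
    P (chainEvent ξ Λ a j m ∩ {o | (ξ m o, ξ n o) ∈ Λ n}) ≤ P (chainEvent ξ Λ a j m) * q n := by
  let Y : Ω → (Finset.range n → X) := fun o i => ξ i o
  have hY : Measurable Y := measurable_pi_lambda _ fun i => hmeas i
  have hYZ : IndepFun Y (ξ n) P := by
    have h := hindep.indepFun_finset (Finset.range n) {n} (by simp) hmeas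
    exact h.comp measurable_id (measurable_pi_apply (⟨n, by simp⟩ : ({n} : Finset ℕ)))
  obtain ⟨S, hS, hSY⟩ :
      MeasurableSet[MeasurableSpace.comap Y inferInstance] (chainEvent ξ Λ a j m) := by
    refine @measurableSet_chainEvent X Ω _ (MeasurableSpace.comap Y inferInstance) ξ Λ hΛ a j m
      fun i hi => ?_
    exact (measurable_pi_apply (⟨i, Finset.mem_range.2 (hi.trans_lt hmn)⟩ : Finset.range n)).comp
      (comap_measurable Y)
  let T : Set ((Finset.range n → X) × X) :=
    {p | (p.1 ⟨m, Finset.mem_range.2 hmn⟩, p.2) ∈ Λ n}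
  have hT : MeasurableSet T :=
    (((measurable_pi_apply _).comp measurable_fst).prodMk measurable_snd) (hΛ n)
  have h := measure_preimage_inter_le hY (hmeas n) hYZ hS hT (q := q n)
    (fun y => by rw [hlaw]; exact hq n _)
  rw [hSY] at h
  exact h

/-- The expected number of chains of length `j` is at most `(∑ q) ^ j`. -/
theorem tsum_measure_chainEvent_le {X Ω : Type*} [MeasurableSpace X] [MeasurableSpace Ω]
    {P : Measure Ω} [IsProbabilityMeasure P] {μ : Measure X} {ξ : ℕ → Ω → X}
    (hmeas : ∀ n, Measurable (ξ n)) (hindep : iIndepFun ξ P) (hlaw : ∀ n, P.map (ξ n) = μ)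
    {Λ : ℕ → Set (X × X)} (hΛ : ∀ n, MeasurableSet (Λ n)) {q : ℕ → ENNReal}
    (hq : ∀ n x, μ (Prod.mk x ⁻¹' Λ n) ≤ q n) (a j : ℕ) :
    ∑' n, P (chainEvent ξ Λ a j n) ≤ (∑' n, q n) ^ j := by
  induction j with
  | zero =>
    rw [tsum_eq_single a fun n hn => by simp [chainEvent, hn]]
    simp [chainEvent]
  | succ j ih =>
    calc ∑' n, P (chainEvent ξ Λ a (j + 1) n)
        ≤ ∑' n, ∑' m, P (chainEvent ξ Λ a j m) * q n := by
          refine ENNReal.tsum_le_tsum fun n => ?_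
          refine (measure_biUnion_finset_le _ _).trans ?_
          refine (Finset.sum_le_sum fun m hm => measure_chainEvent_inter_le hmeas hindep hlaw hΛ hq
            a j (Finset.mem_range.1 hm)).trans ?_
          exact ENNReal.sum_le_tsum _
      _ = (∑' m, P (chainEvent ξ Λ a j m)) * ∑' n, q n := by
          simp_rw [ENNReal.tsum_mul_right, ENNReal.tsum_mul_left]
      _ ≤ (∑' n, q n) ^ (j + 1) := by
          rw [pow_succ]
          gcongr

theorem ae_exists_forall_notMem_chainEvent {X Ω : Type*} [MeasurableSpace X] [MeasurableSpace Ω]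
    {P : Measure Ω} [IsProbabilityMeasure P] {μ : Measure X} {ξ : ℕ → Ω → X}
    (hmeas : ∀ n, Measurable (ξ n)) (hindep : iIndepFun ξ P) (hlaw : ∀ n, P.map (ξ n) = μ)
    {Λ : ℕ → Set (X × X)} (hΛ : ∀ n, MeasurableSet (Λ n)) {q : ℕ → ENNReal}
    (hq : ∀ n x, μ (Prod.mk x ⁻¹' Λ n) ≤ q n) (hsum : ∑' n, q n < 1) :
    ∀ᵐ o ∂P, ∀ a, ∃ j, ∀ n, o ∉ chainEvent ξ Λ a j n := by
  refine ae_all_iff.2 fun a => ?_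
  have hle : ∀ j, P {o | ¬∃ j, ∀ n, o ∉ chainEvent ξ Λ a j n} ≤ (∑' n, q n) ^ j := by
    intro j
    calc P {o | ¬∃ j, ∀ n, o ∉ chainEvent ξ Λ a j n}
        ≤ P (⋃ n, chainEvent ξ Λ a j n) := by
          refine measure_mono fun o ho => ?_
          simp only [mem_ofPred_eq, not_exists, not_forall, not_not] at ho
          exact mem_iUnion.2 (ho j)
      _ ≤ ∑' n, P (chainEvent ξ Λ a j n) := measure_iUnion_le _
      _ ≤ _ := tsum_measure_chainEvent_le hmeas hindep hlaw hΛ hq a j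
  exact le_antisymm (ge_of_tendsto' (ENNReal.tendsto_pow_atTop_nhds_zero_of_lt_one hsum) hle)
    zero_le

/-! ### Uniformly covered points of large lower local dimension -/

theorem exists_first_lt {d : ℕ → ℝ} (hinf : ∀ ε > 0, ∃ n, d n < ε) (hpos : ∀ n, 0 < d n)
    {m M : ℕ} (hm : ∀ i ≤ M, d m ≤ d i) : ∃ n > M, d n < d m ∧ ∀ i < n, d m ≤ d i := by
  classical
  have h := hinf (d m) (hpos m)
  refine ⟨Nat.find h, ?_, Nat.find_spec h, fun i hi => not_lt.1 (Nat.find_min h hi)⟩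
  by_contra! hle
  exact (hm _ hle).not_gt (Nat.find_spec h)

/-- If a point `y` is uniformly covered and is none of the `ξ n`, then the successive records of
`dist (ξ n) y` form an infinite chain, along which each point is within `2 n ^ (-α)` of the next
record `ξ n`. Almost surely there is no such chain near a point of large lower local dimension. -/
theorem ae_forall_mem_range {X Ω : Type*} [MetricSpace X] [SecondCountableTopology X]
    [MeasurableSpace X] [BorelSpace X] [MeasurableSpace Ω]
    {P : Measure Ω} [IsProbabilityMeasure P] {μ : Measure X} {ξ : ℕ → Ω → X}
    (hmeas : ∀ n, Measurable (ξ n)) (hindep : iIndepFun ξ P) (hlaw : ∀ n, P.map (ξ n) = μ)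
    {α s : ℝ} (hα : 0 < α) (hs : 1 < α * s) :
    ∀ᵐ o ∂P, ∀ y, (∀ᶠ r in 𝓝[>] (0 : ℝ), μ (Metric.ball y r) ≤ ENNReal.ofReal (r ^ s)) →
      (∀ᶠ N : ℕ in atTop, ∃ n ≤ N, dist (ξ n o) y < ((N : ℝ) + 1) ^ (-α)) →
      y ∈ range fun n => ξ n o := by
  have : IsProbabilityMeasure μ := by
    rw [← hlaw 0]
    exact Measure.isProbabilityMeasure_map (hmeas 0).aemeasurable
  let q : ℕ → ENNReal := fun n => ENNReal.ofReal ((3 * (n : ℝ) ^ (-α)) ^ s)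
  have hqsum : ∑' n, q n ≠ ⊤ := by
    refine Summable.tsum_ofReal_ne_top ?_
    have h : Summable fun n : ℕ => (3 : ℝ) ^ s * (n : ℝ) ^ (-(α * s)) :=
      (Real.summable_nat_rpow.2 (by linarith)).mul_left _
    refine h.congr fun n => ?_
    rw [Real.mul_rpow (by norm_num) (by positivity), ← Real.rpow_mul (by positivity)]
    ring_nf
  -- Links with end in the finite set `A` are forbidden, to make the sum of the `q n` less than `1`.
  obtain ⟨A, hA⟩ := ((ENNReal.tendsto_tsum_compl_atTop_zero hqsum).eventually_lt_const
    zero_lt_one).exists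
  have hA' : ∑' n, (A : Set ℕ)ᶜ.indicator q n < 1 := by
    rw [← tsum_subtype]
    exact hA
  let Λ : ℕ → Set (X × X) := fun n => {p | n ∉ A ∧ dist p.2 p.1 < 2 * (n : ℝ) ^ (-α) ∧
    μ (Metric.ball p.1 (2 * (n : ℝ) ^ (-α))) ≤ q n}
  have hopen : ∀ ρ : ℝ, MeasurableSet {p : X × X | dist p.2 p.1 < ρ} := fun ρ =>
    (isOpen_lt (continuous_snd.dist continuous_fst) continuous_const).measurableSet
  have hΛ : ∀ n, MeasurableSet (Λ n) := by
    intro n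
    refine (MeasurableSet.const _).inter ((hopen _).inter ?_)
    have h : Measurable fun x : X => μ (Metric.ball x (2 * (n : ℝ) ^ (-α))) :=
      measurable_measure_prodMk_left (hopen _)
    exact (h.comp measurable_fst) measurableSet_Iic
  have hΛq : ∀ n x, μ (Prod.mk x ⁻¹' Λ n) ≤ (A : Set ℕ)ᶜ.indicator q n := by
    intro n x
    by_cases h : n ∉ A ∧ μ (Metric.ball x (2 * (n : ℝ) ^ (-α))) ≤ q n
    · rw [indicator_of_mem (by simpa using h.1)]
      exact (measure_mono fun z hz => hz.2.1).trans h.2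
    · have h0 : Prod.mk x ⁻¹' Λ n = ∅ := by
        ext z
        simp only [Λ, mem_preimage, mem_ofPred_eq, mem_empty_iff_false, iff_false]
        exact fun hz => h ⟨hz.1, hz.2.2⟩
      rw [h0]
      simp
  have hlim : Tendsto (fun n : ℕ => (n : ℝ) ^ (-α)) atTop (𝓝 0) :=
    (tendsto_rpow_neg_atTop hα).comp tendsto_natCast_atTop_atTop
  filter_upwards [ae_exists_forall_notMem_chainEvent hmeas hindep hlaw hΛ hΛq hA'] with o ho y hy hU
  by_contra hrange
  have hpos : ∀ n, 0 < dist (ξ n o) y := fun n => dist_pos.2 fun h => hrange ⟨n, h⟩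
  have hinf : ∀ ε > 0, ∃ n, dist (ξ n o) y < ε := by
    intro ε hε
    have h := ((tendsto_add_atTop_iff_nat 1).2 hlim).eventually_lt_const hε
    obtain ⟨N, ⟨n, -, hn⟩, hN⟩ := (hU.and h).exists
    push_cast at hN
    exact ⟨n, hn.trans hN⟩
  have hball : ∀ᶠ n : ℕ in atTop, μ (Metric.ball y (3 * (n : ℝ) ^ (-α))) ≤ q n := by
    have h3 : Tendsto (fun n : ℕ => 3 * (n : ℝ) ^ (-α)) atTop (𝓝[>] 0) := by
      refine tendsto_nhdsWithin_iff.2 ⟨by simpa using hlim.const_mul 3, ?_⟩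
      filter_upwards [eventually_gt_atTop 0] with n hn
      have : (0 : ℝ) < n := by exact_mod_cast hn
      exact mem_Ioi.2 (by positivity)
    exact h3.eventually hy
  have hnotA : ∀ᶠ n : ℕ in atTop, n ∉ A := by
    rw [← Nat.cofinite_eq_atTop]
    exact A.finite_toSet.compl_mem_cofinite
  obtain ⟨M, hM⟩ := eventually_atTop.1 (hU.and (hball.and hnotA))
  -- Each record beyond time `M` is followed by another one, and the two are linked.
  have hstep : ∀ m, M ≤ m → (∀ i ≤ m, dist (ξ m o) y ≤ dist (ξ i o) y) →
      ∃ n > m, (∀ i ≤ n, dist (ξ n o) y ≤ dist (ξ i o) y) ∧ (ξ m o, ξ n o) ∈ Λ n := by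
    intro m hMm hrec
    obtain ⟨n, hmn, hlt, hmin⟩ := exists_first_lt hinf hpos hrec
    obtain ⟨k, rfl⟩ : ∃ k, n = k + 1 := ⟨n - 1, by omega⟩
    obtain ⟨⟨i, hi, hik⟩, -, -⟩ := hM k (by omega)
    obtain ⟨-, hb, hA⟩ := hM (k + 1) (by omega)
    have hclose : dist (ξ m o) y < ((k + 1 : ℕ) : ℝ) ^ (-α) := by
      push_cast
      exact (hmin i (by omega)).trans_lt hik
    refine ⟨k + 1, hmn, fun i hi => ?_, hA, ?_, ?_⟩
    · rcases hi.lt_or_eq with hi | rfl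
      · exact hlt.le.trans (hmin i hi)
      · exact le_rfl
    · have := dist_triangle_right (ξ (k + 1) o) (ξ m o) y
      simp only
      linarith
    · refine (measure_mono (Metric.ball_subset_ball' ?_)).trans hb
      simp only
      linarith
  obtain ⟨m₀, -, hm₀⟩ := Finset.exists_min_image (Finset.range (M + 1))
    (fun i => dist (ξ i o) y) ⟨0, by simp⟩
  obtain ⟨a, haM, halt, hamin⟩ := exists_first_lt hinf hpos (m := m₀) (M := M)
    fun i hi => hm₀ i (Finset.mem_range.2 (by omega))
  have hchain : ∀ j, ∃ n, M ≤ n ∧ (∀ i ≤ n, dist (ξ n o) y ≤ dist (ξ i o) y) ∧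
      o ∈ chainEvent ξ Λ a j n := by
    intro j
    induction j with
    | zero =>
      refine ⟨a, haM.le, fun i hi => ?_, rfl⟩
      rcases hi.lt_or_eq with hi | rfl
      · exact halt.le.trans (hamin i hi)
      · exact le_rfl
    | succ j ih =>
      obtain ⟨m, hMm, hrec, hmem⟩ := ih
      obtain ⟨n, hmn, hrec', hlink⟩ := hstep m hMm hrec
      exact ⟨n, by omega, hrec', mem_iUnion₂.2 ⟨m, Finset.mem_range.2 hmn, hmem, hlink⟩⟩
  obtain ⟨j, hj⟩ := ho a
  obtain ⟨n, -, -, hn⟩ := hchain j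
  exact hj n hn

/-! ### Local dimensions and measures of small balls -/

theorem measureReal_ball_pos {X : Type*} [MetricSpace X] [MeasurableSpace X] {μ : Measure X}
    [IsFiniteMeasure μ] {y : X} (hy : y ∈ μ.support) {r : ℝ} (hr : 0 < r) :
    0 < μ.real (Metric.ball y r) :=
  ENNReal.toReal_pos ((Measure.mem_support_iff_forall y).1 hy _ (Metric.ball_mem_nhds y hr)).ne'
    (measure_ne_top _ _)

theorem eventually_rpow_le_of_upperLocalDim_lt {X : Type*} [MetricSpace X] [MeasurableSpace X]
    {μ : Measure X} [IsFiniteMeasure μ] {y : X} {s : ℝ} (h : upperLocalDim μ y < (s : EReal)) :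
    ∀ᶠ r in 𝓝[>] (0 : ℝ), r ^ s ≤ μ.real (Metric.ball y r) := by
  unfold upperLocalDim at h
  split_ifs at h with hy
  · filter_upwards [eventually_lt_of_limsup_lt h, Ioo_mem_nhdsGT (zero_lt_one' ℝ)] with r hr hr01
    rw [EReal.coe_lt_coe_iff, div_lt_iff_of_neg (Real.log_neg hr01.1 hr01.2)] at hr
    rw [Real.rpow_def_of_pos hr01.1, mul_comm]
    exact ((Real.lt_log_iff_exp_lt (measureReal_ball_pos hy hr01.1)).1 hr).le
  · exact absurd h not_top_lt

theorem eventually_le_rpow_of_lt_lowerLocalDim {X : Type*} [MetricSpace X] [MeasurableSpace X]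
    {μ : Measure X} [IsFiniteMeasure μ] {y : X} {s : ℝ} (h : (s : EReal) < lowerLocalDim μ y) :
    ∀ᶠ r in 𝓝[>] (0 : ℝ), μ (Metric.ball y r) ≤ ENNReal.ofReal (r ^ s) := by
  unfold lowerLocalDim at h
  split_ifs at h with hy
  · filter_upwards [eventually_lt_of_lt_liminf h, Ioo_mem_nhdsGT (zero_lt_one' ℝ)] with r hr hr01
    rw [EReal.coe_lt_coe_iff, lt_div_iff_of_neg (Real.log_neg hr01.1 hr01.2)] at hr
    rw [← ofReal_measureReal, Real.rpow_def_of_pos hr01.1, mul_comm]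
    exact ENNReal.ofReal_le_ofReal
      ((Real.log_lt_iff_lt_exp (measureReal_ball_pos hy hr01.1)).1 hr).le
  · -- Off the support small balls are null.
    rw [Measure.mem_support_iff_forall] at hy
    push Not at hy
    obtain ⟨U, hU, hU0⟩ := hy
    obtain ⟨δ, hδ, hδU⟩ := Metric.mem_nhds_iff.1 hU
    filter_upwards [Ioo_mem_nhdsGT hδ] with r hr
    exact (measure_mono ((Metric.ball_subset_ball hr.2.le).trans hδU)).trans
      (hU0.trans zero_le)

theorem mem_uniformCoveringSet_iff {X : Type*} [MetricSpace X] {x : ℕ+ → X} {α : ℝ} {y : X} :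
    y ∈ uniformCoveringSet x (fun n => ((n : ℕ) : ℝ) ^ (-α)) ↔
      ∀ᶠ N : ℕ in atTop, ∃ n ≤ N, dist (x n.succPNat) y < ((N : ℝ) + 1) ^ (-α) := by
  simp only [uniformCoveringSet, mem_ofPred_eq]
  rw [← OrderIso.pnatIsoNat.symm.map_atTop, eventually_map]
  refine eventually_congr (Eventually.of_forall fun N => ?_)
  simp only [OrderIso.pnatIsoNat_symm_apply, Nat.succPNat_coe, Nat.succ_eq_add_one, Nat.cast_add,
    Nat.cast_one]
  constructor
  · rintro ⟨n, hn, h⟩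
    refine ⟨n.natPred, ?_, by rwa [PNat.succPNat_natPred]⟩
    rw [← Nat.succPNat_le_succPNat, PNat.succPNat_natPred]
    exact hn
  · rintro ⟨n, hn, h⟩
    exact ⟨n.succPNat, Nat.succPNat_le_succPNat.2 hn, h⟩

end UniformRandomCovering

open UniformRandomCovering MeasureTheory ProbabilityTheory Filter Set in
theorem theorem2p4 {X : Type*} [MetricSpace X] [CompleteSpace X] [TopologicalSpace.SeparableSpace X]
    [MeasurableSpace X] [BorelSpace X]
    {Ω : Type*} [MeasurableSpace Ω] (P : MeasureTheory.Measure Ω)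
    [MeasureTheory.IsProbabilityMeasure P]
    (μ : MeasureTheory.Measure X) (hμ : UniformRandomCovering.SphereNull μ)
    (ω : ℕ+ → Ω → X) (hmeas : ∀ n, Measurable (ω n))
    (hindep : ProbabilityTheory.iIndepFun ω P)
    (hlaw : ∀ n, MeasureTheory.Measure.map (ω n) P = μ)
    (α : ℝ) (hα : 0 < α) :
    ∀ᵐ o ∂P,
      dimH {y : X | UniformRandomCovering.upperLocalDim μ y < ((1 / α : ℝ) : EReal)} ≤
          dimH (UniformRandomCovering.uniformCoveringSet (fun n => ω n o)
            (fun n => ((n : ℕ) : ℝ) ^ (-α))) ∧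
        dimH (UniformRandomCovering.uniformCoveringSet (fun n => ω n o)
            (fun n => ((n : ℕ) : ℝ) ^ (-α))) ≤
          dimH {y : X | UniformRandomCovering.lowerLocalDim μ y ≤ ((1 / α : ℝ) : EReal)} := by
  have : IsProbabilityMeasure μ := by
    rw [← hlaw 1]
    exact Measure.isProbabilityMeasure_map (hmeas 1).aemeasurable
  have : SecondCountableTopology X := UniformSpace.secondCountable_of_separable X
  let ξ : ℕ → Ω → X := fun n => ω n.succPNat
  have hξmeas : ∀ n, Measurable (ξ n) := fun n => hmeas _
  have hξindep : iIndepFun ξ P := hindep.precomp Nat.succPNat_injective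
  have hξlaw : ∀ n, P.map (ξ n) = μ := fun n => hlaw _
  have hlower : ∀ s : ℚ, ∀ᵐ o ∂P, α * s < 1 → ∀ y, (upperLocalDim μ y < ((s : ℝ) : EReal)) →
      y ∈ uniformCoveringSet (fun n => ω n o) (fun n => ((n : ℕ) : ℝ) ^ (-α)) := by
    intro s
    by_cases hs : α * s < 1
    · filter_upwards [ae_forall_eventually_exists_dist_lt hξmeas hξindep hξlaw hα hs] with o ho _ y hy
      exact mem_uniformCoveringSet_iff.2 (ho y (eventually_rpow_le_of_upperLocalDim_lt hy))
    · exact Eventually.of_forall fun o h => absurd h hs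
  have hupper : ∀ s : ℚ, ∀ᵐ o ∂P, 1 < α * s → ∀ y, (((s : ℝ) : EReal) < lowerLocalDim μ y) →
      y ∈ uniformCoveringSet (fun n => ω n o) (fun n => ((n : ℕ) : ℝ) ^ (-α)) →
      y ∈ range fun n => ξ n o := by
    intro s
    by_cases hs : 1 < α * s
    · filter_upwards [ae_forall_mem_range hξmeas hξindep hξlaw hα hs] with o ho _ y hy hyU
      exact ho y (eventually_le_rpow_of_lt_lowerLocalDim hy) (mem_uniformCoveringSet_iff.1 hyU)
    · exact Eventually.of_forall fun o h => absurd h hs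
  filter_upwards [ae_all_iff.2 hlower, ae_all_iff.2 hupper] with o hlow hupp
  constructor
  · refine dimH_mono fun y hy => ?_
    obtain ⟨s, hys, hs⟩ := EReal.lt_iff_exists_rat_btwn.1 hy
    rw [EReal.coe_lt_coe_iff, lt_div_iff₀ hα, mul_comm] at hs
    exact hlow s hs y hys
  · have hsub : uniformCoveringSet (fun n => ω n o) (fun n => ((n : ℕ) : ℝ) ^ (-α)) ⊆
        {y | lowerLocalDim μ y ≤ ((1 / α : ℝ) : EReal)} ∪ range fun n => ξ n o := by
      intro y hyU
      by_cases hy : lowerLocalDim μ y ≤ ((1 / α : ℝ) : EReal)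
      · exact Or.inl hy
      · obtain ⟨s, hs, hys⟩ := EReal.lt_iff_exists_rat_btwn.1 (not_le.1 hy)
        rw [EReal.coe_lt_coe_iff, div_lt_iff₀ hα, mul_comm] at hs
        exact Or.inr (hupp s hs y hys hyU)
    refine (dimH_mono hsub).trans ?_
    rw [dimH_union, (countable_range _).dimH_zero]
    simp
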